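/- **Setting.** Let $\Omega\subset\mathbb R^3$ be a bounded domain (non-empty, open, connected) with smooth boundary, and let $a,b>0$, $\lambda\in\mathbb R$. Write $\|\cdot\|_q$ for the norm of $L^q(\Omega)$ and put $$\lambda_1=\inf\{\|\nabla w\|_2^2: w\in H^1_0(\Omega),\ \|w\|_2=1\},\qquad \Lambda=\inf\{\|\nabla w\|_2^4: w\in H^1_0(\Omega),\ \|w\|_4=1\},$$ and $b_0=b-\lambda/\lambda_1$ if $\lambda\ge 0$, $b_0=b$ if $\lambda<0$. For $w\in H^1_0(\Omega)$ let $$J(w)=\tfrac a4\|\nabla w\|_2^4+\tfrac b2\|\nabla w\|_2^2-\tfrac\lambda2\|w\|_2^2-\tfrac14\|w\|_4^4,\qquad I(w)=a\|\nabla w\|_2^4+b\|\nabla w\|_2^2-\lambda\|w\|_2^2-\|w\|_4^4,$$ and define $$N_3=\{w\in H^1_0(\Omega)\setminus\{0\}: I(w)=0\},\quad N_3^-=\{w\in H^1_0(\Omega): I(w)<0\},\quad d_3=\inf_{w\in N_3}J(w),\quad W_3^-=\{w\in N_3^-: J(w)<d_3\}.$$ For $u_0\in H^2(\Omega)\cap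 H^1_0(\Omega)$ and $u_1\in H^1_0(\Omega)$ put $E(0)=\tfrac12\|u_1\|_2^2+J(u_0)$. A solution on $[0,T)$, $0<T\le\infty$, of $$u_{tt}-\bigl(a\|\nabla u\|_2^2+b\bigr)\Delta u=\lambda u+|u|^2u\ \text{ in }\Omega,\quad t>0,\qquad u(0)=u_0,\ u_t(0)=u_1,\qquad u=0\ \text{ on }\partial\Omega, \tag{K}$$ is a function $u\in C([0,T);H^2(\Omega)\cap H^1_0(\Omega))\cap C^1([0,T);H^1_0(\Omega))\cap C^2([0,T);L^2(\Omega))$ satisfying (K), with the equation understood in $L^2(\Omega)$; $T=T_{\max}$ is its maximal existence time if $u$ does not extend to a solution on a longer interval. **Theorem 2.6.** Assume $0<a<1/\Lambda$, $\lambda<b\lambda_1$ and $(N_3\cup N_3^-)\cap H^2(\Omega)\neq\emptyset$. Let $u$ be a solution of (K) on $[0,T_{\max})$ with initial data $u_0\in H^2(\Omega)\cap H^1_0(\Omega)$, $u_1\in H^1_0(\Omega)$, where $T_{\max}\in(0,\infty]$ is its maximal existence time. 1. $T_{\max}<\infty$ in each of the following cases: - (h1) $E(0)<0$; - (h2) $E(0)=0$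 and $\int_\Omega u_0u_1\,dx>0$; - (h3) $0<E(0)<d_3$ and $u_0\in W_3^-$; - (h4) $E(0)\ge d_3$, $\int_\Omega u_0u_1\,dx>0$ and $\|u_0\|_2^2>\dfrac{4}{b_0\lambda_1}E(0)$. 2. If $E(0)\le 0$ and $\|\nabla u_0\|_2>0$, then $$\|\nabla u(t)\|_2^2\ \ge\ \frac{2b_0\Lambda}{1-a\Lambda}\qquad\text{for all } t\in[0,T_{\max}).$$ -/

import Mathlib

open MeasureTheory TopologicalSpace Set
open scoped Distributions ContDiff

namespace Kirchhoff

noncomputable section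

/-- Three-dimensional Euclidean space. -/
abbrev E3 : Type := EuclideanSpace ℝ (Fin 3)

/-- The boundary of `Ω` is smooth: near each of its points `Ω` is the sublevel set `{ρ < 0}` of a
smooth function `ρ` whose differential does not vanish at that point. -/
def HasSmoothBoundary (Ω : Set E3) : Prop :=
  ∀ x ∈ frontier Ω, ∃ U : Set E3, IsOpen U ∧ x ∈ U ∧ ∃ ρ : E3 → ℝ,
    ContDiff ℝ ∞ ρ ∧ fderiv ℝ ρ x ≠ 0 ∧ Ω ∩ U = {y ∈ U | ρ y < 0}

/-- The classical partial derivative `∂φ/∂xᵢ`. -/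
def partialDeriv (i : Fin 3) (φ : E3 → ℝ) (x : E3) : ℝ :=
  fderiv ℝ φ x (EuclideanSpace.single i 1)

/-- The real Hilbert space `L²(Ω)`. -/
abbrev L2 (Ω : Opens E3) : Type := Lp ℝ 2 ((volume : Measure E3).restrict (Ω : Set E3))

/-- Pairs `(v, g)` of a function and a candidate for its gradient, with
`‖(v, g)‖² = ‖v‖₂² + ‖g₁‖₂² + ‖g₂‖₂² + ‖g₃‖₂²`. -/
abbrev Jet1 (Ω : Opens E3) : Type := WithLp 2 (L2 Ω × PiLp 2 (fun _ : Fin 3 => L2 Ω))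

/-- Triples `((v, g), h)`, where `h (i, j)` is a candidate for `∂²v/∂xⱼ∂xᵢ`, with the `H²` norm. -/
abbrev Jet2 (Ω : Opens E3) : Type :=
  WithLp 2 (Jet1 Ω × PiLp 2 (fun _ : Fin 3 × Fin 3 => L2 Ω))

/-- `g` is the weak derivative of `v` on `Ω` in the direction of the `i`-th coordinate. -/
def IsWeakDeriv {Ω : Opens E3} (i : Fin 3) (v g : L2 Ω) : Prop :=
  ∀ φ : 𝓓(Ω, ℝ),
    ∫ x in (Ω : Set E3), v x * partialDeriv i φ x = - ∫ x in (Ω : Set E3), g x * φ x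

theorem partialDeriv_memLp {Ω : Opens E3} (i : Fin 3) (φ : 𝓓(Ω, ℝ)) :
    MemLp (partialDeriv i φ) 2 ((volume : Measure E3).restrict (Ω : Set E3)) := by
  have hc : Continuous (partialDeriv i φ) := by
    have := φ.contDiff.continuous_fderiv (by simp)
    unfold partialDeriv
    fun_prop
  have hs : HasCompactSupport (partialDeriv i φ) :=
    φ.hasCompactSupport.fderiv_apply (𝕜 := ℝ) (EuclideanSpace.single i 1)
  exact hc.memLp_of_hasCompactSupport hs

theorem testFunction_memLp {Ω : Opens E3} (φ : 𝓓(Ω, ℝ)) :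
    MemLp φ 2 ((volume : Measure E3).restrict (Ω : Set E3)) :=
  φ.continuous.memLp_of_hasCompactSupport φ.hasCompactSupport

theorem IsWeakDeriv.add {Ω : Opens E3} {i : Fin 3} {v g v' g' : L2 Ω} (h : IsWeakDeriv i v g)
    (h' : IsWeakDeriv i v' g') : IsWeakDeriv i (v + v') (g + g') := by
  intro φ
  have e1 : ∫ x in (Ω : Set E3), (v + v' : L2 Ω) x * partialDeriv i φ x
      = ∫ x in (Ω : Set E3), (v x * partialDeriv i φ x + v' x * partialDeriv i φ x) := by
    refine integral_congr_ae ?_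
    filter_upwards [Lp.coeFn_add v v'] with x hx
    rw [hx, Pi.add_apply, add_mul]
  have e2 : ∫ x in (Ω : Set E3), (g + g' : L2 Ω) x * φ x
      = ∫ x in (Ω : Set E3), (g x * φ x + g' x * φ x) := by
    refine integral_congr_ae ?_
    filter_upwards [Lp.coeFn_add g g'] with x hx
    rw [hx, Pi.add_apply, add_mul]
  have a1 : ∫ x in (Ω : Set E3), (v x * partialDeriv i φ x + v' x * partialDeriv i φ x)
      = (∫ x in (Ω : Set E3), v x * partialDeriv i φ x)
        + ∫ x in (Ω : Set E3), v' x * partialDeriv i φ x :=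
    integral_add ((Lp.memLp v).integrable_mul (partialDeriv_memLp i φ))
      ((Lp.memLp v').integrable_mul (partialDeriv_memLp i φ))
  have a2 : ∫ x in (Ω : Set E3), (g x * φ x + g' x * φ x)
      = (∫ x in (Ω : Set E3), g x * φ x) + ∫ x in (Ω : Set E3), g' x * φ x :=
    integral_add ((Lp.memLp g).integrable_mul (testFunction_memLp φ))
      ((Lp.memLp g').integrable_mul (testFunction_memLp φ))
  rw [e1, e2, a1, a2, h φ, h' φ]
  ring

theorem IsWeakDeriv.smul {Ω : Opens E3} {i : Fin 3} {v g : L2 Ω} (c : ℝ)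
    (h : IsWeakDeriv i v g) : IsWeakDeriv i (c • v) (c • g) := by
  intro φ
  have e1 : ∫ x in (Ω : Set E3), (c • v : L2 Ω) x * partialDeriv i φ x
      = ∫ x in (Ω : Set E3), c * (v x * partialDeriv i φ x) := by
    refine integral_congr_ae ?_
    filter_upwards [Lp.coeFn_smul c v] with x hx
    rw [hx, Pi.smul_apply, smul_eq_mul, mul_assoc]
  have e2 : ∫ x in (Ω : Set E3), (c • g : L2 Ω) x * φ x
      = ∫ x in (Ω : Set E3), c * (g x * φ x) := by
    refine integral_congr_ae ?_
    filter_upwards [Lp.coeFn_smul c g] with x hx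
    rw [hx, Pi.smul_apply, smul_eq_mul, mul_assoc]
  rw [e1, e2, integral_const_mul, integral_const_mul, h φ]
  ring

theorem IsWeakDeriv.zero {Ω : Opens E3} {i : Fin 3} : IsWeakDeriv i (0 : L2 Ω) 0 := by
  intro φ
  have e1 : ∫ x in (Ω : Set E3), (0 : L2 Ω) x * partialDeriv i φ x = 0 := by
    refine integral_eq_zero_of_ae ?_
    filter_upwards [Lp.coeFn_zero ℝ 2 ((volume : Measure E3).restrict (Ω : Set E3))] with x hx
    rw [hx]
    simp
  have e2 : ∫ x in (Ω : Set E3), (0 : L2 Ω) x * φ x = 0 := by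
    refine integral_eq_zero_of_ae ?_
    filter_upwards [Lp.coeFn_zero ℝ 2 ((volume : Measure E3).restrict (Ω : Set E3))] with x hx
    rw [hx]
    simp
  rw [e1, e2, neg_zero]

/-- The pair `(φ, ∇φ)` of a test function and its gradient. -/
def testJet {Ω : Opens E3} (φ : 𝓓(Ω, ℝ)) : Jet1 Ω :=
  WithLp.toLp 2 ((testFunction_memLp φ).toLp φ,
    WithLp.toLp 2 fun i => (partialDeriv_memLp i φ).toLp (partialDeriv i φ))

/-- `H¹₀(Ω)`, the closure of `C_c^∞(Ω)` for the `H¹` norm. Its elements are the pairs `(v, ∇v)`. -/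
def H10 (Ω : Opens E3) : Submodule ℝ (Jet1 Ω) :=
  (Submodule.span ℝ (range (testJet (Ω := Ω)))).topologicalClosure

/-- `H²(Ω)`: functions in `L²(Ω)` with all weak derivatives of order at most two in `L²(Ω)`. Its
elements are the triples `((v, ∇v), D²v)`. -/
def H2 (Ω : Opens E3) : Submodule ℝ (Jet2 Ω) where
  carrier := {w | (∀ i, IsWeakDeriv i w.fst.fst (w.fst.snd i)) ∧
    ∀ i j, IsWeakDeriv j (w.fst.snd i) (w.snd (i, j))}
  add_mem' := fun ha hb =>
    ⟨fun i => (ha.1 i).add (hb.1 i), fun i j => (ha.2 i j).add (hb.2 i j)⟩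
  zero_mem' := ⟨fun _ => IsWeakDeriv.zero, fun _ _ => IsWeakDeriv.zero⟩
  smul_mem' := fun c _ ha =>
    ⟨fun i => (ha.1 i).smul c, fun i j => (ha.2 i j).smul c⟩

/-- `H²(Ω) ∩ H¹₀(Ω)`, with the `H²` norm. -/
def H2H10 (Ω : Opens E3) : Submodule ℝ (Jet2 Ω) :=
  H2 Ω ⊓ (H10 Ω).comap (WithLp.fstₗ 2 ℝ (Jet1 Ω) (PiLp 2 (fun _ : Fin 3 × Fin 3 => L2 Ω)))

variable {Ω : Opens E3}

/-- An element of `H¹₀(Ω)` as an element of `L²(Ω)`. -/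
def fn (w : H10 Ω) : L2 Ω := (w : Jet1 Ω).fst

/-- The gradient of an element of `H¹₀(Ω)`; its norm is `‖∇w‖₂`. -/
def grad (w : H10 Ω) : PiLp 2 (fun _ : Fin 3 => L2 Ω) := (w : Jet1 Ω).snd

/-- The inclusion of `H²(Ω) ∩ H¹₀(Ω)` in `H¹₀(Ω)`. -/
def toH10 (w : H2H10 Ω) : H10 Ω := ⟨(w : Jet2 Ω).fst, w.2.2⟩

/-- The weak Laplacian on `H²(Ω) ∩ H¹₀(Ω)`. -/
def laplacian (w : H2H10 Ω) : L2 Ω := ∑ i : Fin 3, (w : Jet2 Ω).snd (i, i)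

/-- The principal Dirichlet eigenvalue of `-Δ` on `Ω`. -/
def lambda1 (Ω : Opens E3) : ℝ :=
  sInf {r | ∃ w : H10 Ω, ‖fn w‖ = 1 ∧ r = ‖grad w‖ ^ 2}

/-- `Λ = inf {‖∇w‖₂⁴ : w ∈ H¹₀(Ω), ‖w‖₄ = 1}`. -/
def capLambda (Ω : Opens E3) : ℝ :=
  sInf {r | ∃ w : H10 Ω,
    eLpNorm (fn w) 4 ((volume : Measure E3).restrict (Ω : Set E3)) = 1 ∧ r = ‖grad w‖ ^ 4}

/-- The constant `b₀`. -/
def bZero (Ω : Opens E3) (b lam : ℝ) : ℝ := if 0 ≤ lam then b - lam / lambda1 Ω else b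

/-- The potential energy `J`. -/
def potential (a b lam : ℝ) (w : H10 Ω) : ℝ :=
  a / 4 * ‖grad w‖ ^ 4 + b / 2 * ‖grad w‖ ^ 2 - lam / 2 * ‖fn w‖ ^ 2
    - 1 / 4 * ∫ x in (Ω : Set E3), |fn w x| ^ 4

/-- The Nehari functional `I`. -/
def nehari (a b lam : ℝ) (w : H10 Ω) : ℝ :=
  a * ‖grad w‖ ^ 4 + b * ‖grad w‖ ^ 2 - lam * ‖fn w‖ ^ 2 - ∫ x in (Ω : Set E3), |fn w x| ^ 4

/-- The initial energy `E(0)` of the data `(u₀, u₁)`. -/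
def initialEnergy (a b lam : ℝ) (u0 u1 : H10 Ω) : ℝ :=
  1 / 2 * ‖fn u1‖ ^ 2 + potential a b lam u0

/-- The Nehari manifold `N₃`. -/
def nehariSet (Ω : Opens E3) (a b lam : ℝ) : Set (H10 Ω) := {w | w ≠ 0 ∧ nehari a b lam w = 0}

/-- The outside space `N₃⁻`. -/
def nehariMinus (Ω : Opens E3) (a b lam : ℝ) : Set (H10 Ω) := {w | nehari a b lam w < 0}

/-- The depth `d₃` of the potential well. -/
def depth (Ω : Opens E3) (a b lam : ℝ) : ℝ := sInf (potential a b lam '' nehariSet Ω a b lam)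

/-- The unstable set `W₃⁻`. -/
def unstableSet (Ω : Opens E3) (a b lam : ℝ) : Set (H10 Ω) :=
  {w | potential a b lam w < depth Ω a b lam} ∩ nehariMinus Ω a b lam

/-- The time interval `[0, T)`, where `T` may be infinite. -/
def timeInterval (T : EReal) : Set ℝ := {t | 0 ≤ t ∧ (t : EReal) < T}

/-- `u` belongs to `C([0,T); H² ∩ H¹₀) ∩ C¹([0,T); H¹₀) ∩ C²([0,T); L²)` and solves
`u_tt - (a ‖∇u‖₂² + b) Δu = λ u + |u|² u` with `u(0) = u₀` and `u_t(0) = u₁`. Derivatives at the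
left endpoint are one-sided; the boundary condition is contained in the space `H¹₀`. -/
structure IsSolution (a b lam : ℝ) (u0 : H2H10 Ω) (u1 : H10 Ω) (T : EReal) (u : ℝ → H2H10 Ω) :
    Prop where
  pos : 0 < T
  continuousOn : ContinuousOn u (timeInterval T)
  contDiffOn_one : ContDiffOn ℝ 1 (fun t => toH10 (u t)) (timeInterval T)
  contDiffOn_two : ContDiffOn ℝ 2 (fun t => fn (toH10 (u t))) (timeInterval T)
  equation : ∀ t ∈ timeInterval T, 0 < t →
    ∀ᵐ x ∂((volume : Measure E3).restrict (Ω : Set E3)),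
      (iteratedDerivWithin 2 (fun s => fn (toH10 (u s))) (timeInterval T) t) x
          - (a * ‖grad (toH10 (u t))‖ ^ 2 + b) * laplacian (u t) x
        = lam * fn (toH10 (u t)) x + |fn (toH10 (u t)) x| ^ 2 * fn (toH10 (u t)) x
  initial_position : u 0 = u0
  initial_velocity : derivWithin (fun t => toH10 (u t)) (timeInterval T) 0 = u1

/-- `u` is a solution on `[0, T)` and no solution on a longer interval extends it, so that `T` is
its maximal existence time. -/
def IsMaximalSolution (a b lam : ℝ) (u0 : H2H10 Ω) (u1 : H10 Ω) (T : EReal) (u : ℝ → H2H10 Ω) :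
    Prop :=
  IsSolution a b lam u0 u1 T u ∧
    ∀ (T' : EReal) (v : ℝ → H2H10 Ω), T < T' → IsSolution a b lam u0 u1 T' v →
      ¬ EqOn u v (timeInterval T)

end

end Kirchhoff

open Kirchhoff

/-! The blow-up is Levine's concavity argument for `F(t) = ‖u(t)‖₂²`. Write `B(w) = b‖∇w‖₂² -
λ‖w‖₂²`, so that `4J = I + B`. Testing the equation with `u` gives `F'' = 2‖u_t‖₂² - 2I(u)`, and
eliminating `I` by conservation of energy gives `F'' = 6‖u_t‖₂² - 8E(0) + 2B(u)`
(`IsSolution.hasDerivAt_inner_velocity`). Wherever `B(u) ≥ 4E(0)`, Cauchy–Schwarz yields `F F'' ≥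
(3/2) F'²`, that is, `F^(-1/2)` is concave; once `F' > 0` it would reach zero in finite time
(`not_global_of_concavity`). A solution on `[0, ∞)` is therefore impossible as soon as `B(u) ≥
4E(0)` and `F' > 0` hold from some time on.

The four cases secure these two conditions. Since `B(w) ≥ b₀‖∇w‖₂² ≥ 0`, case (h1) has a uniform gap
between `B` and `4E(0)`. In (h3) the unstable set is invariant, and scaling down to the Nehari
manifold gives `B ≥ 4d₃` on `N₃⁻` (`four_mul_depth_le`), again a uniform gap. A gap makes `F''`
bounded below by a positive constant, so `F'` becomes positive by itself. In (h2) and (h4) there is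
no gap, but `F'(0) > 0` is given and `B ≥ k‖·‖₂²`, with `k = 0` and `k = b₀λ₁` respectively;
positivity of `F'` and largeness of `F` then sustain each other.

For the lower bound, `J ≤ 0` forces `‖∇w‖₂` to be zero or above the stated threshold, and a
continuous curve cannot cross the gap. -/

open Filter Topology
open scoped ENNReal RealInnerProductSpace

namespace Kirchhoff

noncomputable section

variable {Ω : Opens E3}

/-- Lebesgue measure on `Ω`. -/
abbrev domainMeasure (Ω : Opens E3) : Measure E3 := (volume : Measure E3).restrict (Ω : Set E3)

/-- The inclusion of `H¹₀(Ω)` in `L²(Ω)` as a continuous linear map. -/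
def fnL (Ω : Opens E3) : H10 Ω →L[ℝ] L2 Ω := (WithLp.fstL 2 ℝ _ _).comp (H10 Ω).subtypeL

/-- The gradient on `H¹₀(Ω)` as a continuous linear map. -/
def gradL (Ω : Opens E3) : H10 Ω →L[ℝ] PiLp 2 (fun _ : Fin 3 => L2 Ω) :=
  (WithLp.sndL 2 ℝ _ _).comp (H10 Ω).subtypeL

theorem gradL_apply (w : H10 Ω) : gradL Ω w = grad w := rfl

theorem fn_smul (c : ℝ) (w : H10 Ω) : fn (c • w) = c • fn w := (fnL Ω).map_smul c w

theorem grad_smul (c : ℝ) (w : H10 Ω) : grad (c • w) = c • grad w := (gradL Ω).map_smul c w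

theorem continuous_fn : Continuous (fn : H10 Ω → L2 Ω) := (fnL Ω).continuous

theorem continuous_grad : Continuous (grad (Ω := Ω)) := (gradL Ω).continuous

theorem norm_grad_le (w : H10 Ω) : ‖grad w‖ ≤ ‖w‖ := by
  have h : ‖w‖ ^ 2 = ‖fn w‖ ^ 2 + ‖grad w‖ ^ 2 := WithLp.prod_norm_sq_eq_of_L2 (w : Jet1 Ω)
  exact abs_le_of_sq_le_sq' (by nlinarith [sq_nonneg ‖fn w‖]) (norm_nonneg _) |>.2

/-! ### The Poincaré inequality -/

theorem lambda1_mul_le (w : H10 Ω) : lambda1 Ω * ‖fn w‖ ^ 2 ≤ ‖grad w‖ ^ 2 := by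
  rcases (norm_nonneg (fn w)).eq_or_lt with h | h
  · simp [← h]
  have hle : lambda1 Ω ≤ ‖grad (‖fn w‖⁻¹ • w)‖ ^ 2 := by
    refine csInf_le ⟨0, ?_⟩ ⟨_, ?_, rfl⟩
    · rintro r ⟨w, -, rfl⟩
      positivity
    · rw [fn_smul, norm_smul, norm_inv, norm_norm, inv_mul_cancel₀ h.ne']
  rw [grad_smul, norm_smul, norm_inv, norm_norm, mul_pow, inv_pow] at hle
  calc lambda1 Ω * ‖fn w‖ ^ 2
      ≤ ((‖fn w‖ ^ 2)⁻¹ * ‖grad w‖ ^ 2) * ‖fn w‖ ^ 2 := by gcongr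
    _ = ‖grad w‖ ^ 2 := by field_simp

/-! ### The embedding in `L⁴` -/

theorem capLambda_mul_le_of_memLp {w : H10 Ω} (hw : MemLp (fn w) 4 (domainMeasure Ω)) :
    capLambda Ω * (eLpNorm (fn w) 4 (domainMeasure Ω)).toReal ^ 4 ≤ ‖grad w‖ ^ 4 := by
  set n := (eLpNorm (fn w) 4 (domainMeasure Ω)).toReal with hn
  have hn0 : 0 ≤ n := ENNReal.toReal_nonneg
  rcases hn0.eq_or_lt with h | h
  · simp [← h]
  have hle : capLambda Ω ≤ ‖grad (n⁻¹ • w)‖ ^ 4 := by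
    refine csInf_le ⟨0, ?_⟩ ⟨_, ?_, rfl⟩
    · rintro r ⟨w, -, rfl⟩
      positivity
    · rw [fn_smul, eLpNorm_congr_ae (Lp.coeFn_smul _ _), eLpNorm_const_smul,
        ← ENNReal.ofReal_toReal hw.eLpNorm_ne_top, ← hn, Real.enorm_of_nonneg (by positivity),
        ← ENNReal.ofReal_mul (by positivity), inv_mul_cancel₀ h.ne', ENNReal.ofReal_one]
  rw [grad_smul, norm_smul, norm_inv, Real.norm_of_nonneg h.le, mul_pow, inv_pow] at hle
  calc capLambda Ω * n ^ 4
      ≤ ((n ^ 4)⁻¹ * ‖grad w‖ ^ 4) * n ^ 4 := by gcongr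
    _ = ‖grad w‖ ^ 4 := by field_simp

/-- The Sobolev inequality in terms of `√√Λ = Λ ^ (1/4)`. -/
theorem eLpNorm_le_of_memLp (hL : 0 < capLambda Ω) {w : H10 Ω}
    (hw : MemLp (fn w) 4 (domainMeasure Ω)) :
    eLpNorm (fn w) 4 (domainMeasure Ω)
      ≤ ENNReal.ofReal (‖grad w‖ / √√(capLambda Ω)) := by
  have h := capLambda_mul_le_of_memLp hw
  rw [← ENNReal.ofReal_toReal hw.eLpNorm_ne_top]
  apply ENNReal.ofReal_le_ofReal
  set n := (eLpNorm (fn w) 4 (domainMeasure Ω)).toReal with hn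
  have hs : 0 < √√(capLambda Ω) := by positivity
  have h4 : √√(capLambda Ω) ^ 4 = capLambda Ω := by
    rw [show 4 = 2 * 2 from rfl, pow_mul, Real.sq_sqrt (by positivity), Real.sq_sqrt hL.le]
  rw [le_div_iff₀ hs]
  refine le_of_pow_le_pow_left₀ (by norm_num : (4 : ℕ) ≠ 0) (norm_nonneg _) ?_
  rw [mul_pow, h4, mul_comm]
  exact h

theorem memLp_four_of_mem_span {x : Jet1 Ω}
    (hx : x ∈ Submodule.span ℝ (range (testJet (Ω := Ω)))) :
    MemLp x.fst 4 (domainMeasure Ω) := by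
  induction hx using Submodule.span_induction with
  | mem x h =>
    obtain ⟨φ, rfl⟩ := h
    have h4 : MemLp φ 4 (domainMeasure Ω) :=
      φ.continuous.memLp_of_hasCompactSupport φ.hasCompactSupport
    exact h4.ae_eq (testFunction_memLp φ).coeFn_toLp.symm
  | zero => exact (MemLp.zero (ε := ℝ)).ae_eq (Lp.coeFn_zero ℝ 2 (domainMeasure Ω)).symm
  | add x y _ _ hx hy => exact (hx.add hy).ae_eq (Lp.coeFn_add x.fst y.fst).symm
  | smul c x _ hx => exact (hx.const_smul c).ae_eq (Lp.coeFn_smul c x.fst).symm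

theorem exists_seq_span_tendsto (w : H10 Ω) :
    ∃ x : ℕ → H10 Ω, (∀ n, (x n : Jet1 Ω) ∈ Submodule.span ℝ (range (testJet (Ω := Ω)))) ∧
      Tendsto x atTop (𝓝 w) := by
  obtain ⟨x, hx, hlim⟩ := mem_closure_iff_seq_limit.1 w.2
  exact ⟨fun n => ⟨x n, subset_closure (hx n)⟩, hx, tendsto_subtype_rng.2 hlim⟩

/-- Combinations of test functions lie in `L⁴`, where the inequality follows by normalization;
Fatou's lemma along an a.e. convergent subsequence carries it to the `H¹` closure. Membership of
`H¹₀` functions in `L⁴` is a consequence. -/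
theorem eLpNorm_four_le (hL : 0 < capLambda Ω) (w : H10 Ω) :
    eLpNorm (fn w) 4 (domainMeasure Ω)
      ≤ ENNReal.ofReal (‖grad w‖ / √√(capLambda Ω)) := by
  obtain ⟨x, hx, hlim⟩ := exists_seq_span_tendsto w
  have hfn : Tendsto (fun n => fn (x n)) atTop (𝓝 (fn w)) := (continuous_fn.tendsto w).comp hlim
  have hgrad : Tendsto (fun n => grad (x n)) atTop (𝓝 (grad w)) :=
    (continuous_grad.tendsto w).comp hlim
  obtain ⟨k, hk, hae⟩ := (tendstoInMeasure_of_tendsto_Lp hfn).exists_seq_tendsto_ae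
  have hbound : Tendsto (fun n => ENNReal.ofReal (‖grad (x (k n))‖ / √√(capLambda Ω))) atTop
      (𝓝 (ENNReal.ofReal (‖grad w‖ / √√(capLambda Ω)))) :=
    ENNReal.tendsto_ofReal ((hgrad.norm.div_const _).comp hk.tendsto_atTop)
  refine (Lp.eLpNorm_lim_le_liminf_eLpNorm
    (fun n => (Lp.memLp (fn (x (k n)))).aestronglyMeasurable) _ hae).trans ?_
  rw [← hbound.liminf_eq]
  exact liminf_le_liminf (Eventually.of_forall fun n =>
    eLpNorm_le_of_memLp hL (memLp_four_of_mem_span (hx (k n))))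

theorem memLp_four (hL : 0 < capLambda Ω) (w : H10 Ω) : MemLp (fn w) 4 (domainMeasure Ω) :=
  ⟨(Lp.memLp (fn w)).aestronglyMeasurable,
    (eLpNorm_four_le hL w).trans_lt ENNReal.ofReal_lt_top⟩

instance fact_one_le_four : Fact ((1 : ℝ≥0∞) ≤ 4) := ⟨by norm_num⟩

/-- The embedding of `H¹₀(Ω)` in `L⁴(Ω)`. -/
def fourL (hL : 0 < capLambda Ω) : H10 Ω →L[ℝ] Lp ℝ 4 (domainMeasure Ω) :=
  LinearMap.mkContinuous
    { toFun := fun w => (memLp_four hL w).toLp (fn w)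
      map_add' := fun v w => by
        rw [← MemLp.toLp_add]
        exact MemLp.toLp_congr _ _ (Lp.coeFn_add (fn v) (fn w))
      map_smul' := fun c w => by
        rw [RingHom.id_apply, ← MemLp.toLp_const_smul]
        exact MemLp.toLp_congr _ _ ((Lp.coeFn_smul c (fn w))) }
    (√√(capLambda Ω))⁻¹ fun w => by
      change ‖(memLp_four hL w).toLp (fn w)‖ ≤ _
      rw [Lp.norm_toLp]
      refine (ENNReal.toReal_le_of_le_ofReal (by positivity) (eLpNorm_four_le hL w)).trans ?_
      rw [div_eq_inv_mul]
      gcongr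
      exact norm_grad_le w

theorem coeFn_fourL (hL : 0 < capLambda Ω) (w : H10 Ω) :
    fourL hL w =ᵐ[domainMeasure Ω] fn w :=
  (memLp_four hL w).coeFn_toLp

/-! ### Products of `H¹₀` functions and the quartic term -/

instance holderTriple_four : ENNReal.HolderTriple 4 4 2 where
  inv_add_inv_eq_inv := by
    rw [← two_mul, show (4 : ℝ≥0∞) = 2 * 2 by norm_num,
      ENNReal.mul_inv (by simp) (by simp), ← mul_assoc,
      ENNReal.mul_inv_cancel (by simp) (by simp), one_mul]

/-- The product of two elements of `H¹₀(Ω)` as an element of `L²(Ω)`. -/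
def mulL (hL : 0 < capLambda Ω) : H10 Ω →L[ℝ] H10 Ω →L[ℝ] L2 Ω :=
  ((ContinuousLinearMap.mul ℝ ℝ).holderL (domainMeasure Ω) 4 4 2).bilinearComp
    (fourL hL) (fourL hL)

theorem coeFn_mulL (hL : 0 < capLambda Ω) (v w : H10 Ω) :
    mulL hL v w =ᵐ[domainMeasure Ω] fun x => fn v x * fn w x := by
  have h : mulL hL v w =ᵐ[domainMeasure Ω]
      fun x => ContinuousLinearMap.mul ℝ ℝ (fourL hL v x) (fourL hL w x) :=
    ContinuousLinearMap.coeFn_holder _ _ _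
  filter_upwards [h, coeFn_fourL hL v, coeFn_fourL hL w] with x h1 h2 h3
  rw [h1, h2, h3, ContinuousLinearMap.mul_apply']

theorem mulL_comm (hL : 0 < capLambda Ω) (v w : H10 Ω) : mulL hL v w = mulL hL w v := by
  refine Lp.ext ?_
  filter_upwards [coeFn_mulL hL v w, coeFn_mulL hL w v] with x h1 h2
  rw [h1, h2, mul_comm]

theorem inner_L2 (v w : L2 Ω) : ⟪v, w⟫ = ∫ x in (Ω : Set E3), v x * w x := by
  rw [L2.inner_def]
  refine integral_congr_ae (Eventually.of_forall fun x => ?_)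
  simp [mul_comm]

/-- Writing the quartic term as the squared `L²` norm of `w·w` makes its continuity and its
derivative consequences of the boundedness of the bilinear map `mulL`. -/
theorem integral_abs_pow_four (hL : 0 < capLambda Ω) (w : H10 Ω) :
    ∫ x in (Ω : Set E3), |fn w x| ^ 4 = ‖mulL hL w w‖ ^ 2 := by
  rw [← real_inner_self_eq_norm_sq, inner_L2]
  refine integral_congr_ae ?_
  filter_upwards [coeFn_mulL hL w w] with x hx
  rw [hx, show |fn w x| ^ 4 = (|fn w x| ^ 2) ^ 2 by ring, sq_abs]
  ring

theorem integral_abs_pow_four_eq_eLpNorm (hL : 0 < capLambda Ω) (w : H10 Ω) :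
    ∫ x in (Ω : Set E3), |fn w x| ^ 4 = (eLpNorm (fn w) 4 (domainMeasure Ω)).toReal ^ 4 := by
  rw [MemLp.eLpNorm_eq_integral_rpow_norm (by norm_num) (by norm_num) (memLp_four hL w)]
  have h0 : 0 ≤ ∫ x in (Ω : Set E3), |fn w x| ^ 4 := integral_nonneg fun x => by positivity
  have e : ∀ x, ‖fn w x‖ ^ (ENNReal.toReal 4) = |fn w x| ^ 4 := fun x => by
    rw [show ENNReal.toReal 4 = ((4 : ℕ) : ℝ) by norm_num, Real.rpow_natCast, Real.norm_eq_abs]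
  simp_rw [e]
  rw [ENNReal.toReal_ofReal (by positivity), ← Real.rpow_natCast, ← Real.rpow_mul h0]
  norm_num

/-- The Sobolev inequality with the best constant. -/
theorem capLambda_mul_integral_le (hL : 0 < capLambda Ω) (w : H10 Ω) :
    capLambda Ω * ∫ x in (Ω : Set E3), |fn w x| ^ 4 ≤ ‖grad w‖ ^ 4 := by
  rw [integral_abs_pow_four_eq_eLpNorm hL]
  exact capLambda_mul_le_of_memLp (memLp_four hL w)

/-- Hölder on a set of finite measure bounds `‖v‖₂` by `‖v‖₄`, hence by `‖∇v‖₂`. A nonzero `w` is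
required because the real infimum of the empty set is `0`. -/
theorem lambda1_pos (hL : 0 < capLambda Ω) (hbdd : Bornology.IsBounded (Ω : Set E3))
    {w : H10 Ω} (hw : fn w ≠ 0) : 0 < lambda1 Ω := by
  set V : ℝ≥0∞ := domainMeasure Ω univ ^ (1 / (2 : ℝ) - 1 / 4) with hV
  have hVtop : V ≠ ⊤ := by
    refine ENNReal.rpow_ne_top_of_nonneg (by norm_num) ?_
    rw [Measure.restrict_apply_univ]
    exact hbdd.measure_lt_top.ne
  have key : ∀ v : H10 Ω, ‖fn v‖ ≤ ‖grad v‖ / √√(capLambda Ω) * V.toReal := by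
    intro v
    have h1 := eLpNorm_le_eLpNorm_mul_rpow_measure_univ (p := 2) (q := 4) (by norm_num)
      (Lp.memLp (fn v)).aestronglyMeasurable
    have h2 : eLpNorm (fn v) 2 (domainMeasure Ω)
        ≤ ENNReal.ofReal (‖grad v‖ / √√(capLambda Ω) * V.toReal) := by
      rw [ENNReal.ofReal_mul (by positivity), ENNReal.ofReal_toReal hVtop]
      refine h1.trans ?_
      rw [hV]
      norm_num only [ENNReal.toReal_ofNat]
      gcongr
      exact eLpNorm_four_le hL v
    rw [Lp.norm_def]
    exact ENNReal.toReal_le_of_le_ofReal (by positivity) h2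
  have hn : 0 < ‖fn w‖ := norm_pos_iff.2 hw
  have hs : 0 < √√(capLambda Ω) := by positivity
  have hV0 : 0 < V.toReal := by
    refine lt_of_le_of_ne ENNReal.toReal_nonneg fun h => ?_
    have := key w
    rw [← h, mul_zero] at this
    linarith
  refine lt_of_lt_of_le (b := (√√(capLambda Ω) / V.toReal) ^ 2) (by positivity) ?_
  refine le_csInf ⟨_, ‖fn w‖⁻¹ • w, ?_, rfl⟩ ?_
  · rw [fn_smul, norm_smul, norm_inv, norm_norm, inv_mul_cancel₀ hn.ne']
  · rintro r ⟨v, hv, rfl⟩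
    have := key v
    rw [hv] at this
    gcongr
    rw [div_le_iff₀ hV0]
    rw [div_mul_eq_mul_div, le_div_iff₀ hs] at this
    linarith

/-! ### Integration by parts -/

/-- The weak Laplacian paired with a function of `H¹₀(Ω)`. -/
theorem inner_laplacian (w : H2H10 Ω) (v : H10 Ω) :
    ⟪laplacian w, fn v⟫ = - ⟪grad (toH10 w), grad v⟫ := by
  -- For test functions this is the definition of the second weak derivatives; both pairings are
  -- continuous in the `H¹` norm, so the identity passes to the closure.
  have htest : ∀ x ∈ Submodule.span ℝ (range (testJet (Ω := Ω))),
      ⟪laplacian w, x.fst⟫ + ⟪grad (toH10 w), x.snd⟫ = 0 := by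
    intro x hx
    induction hx using Submodule.span_induction with
    | mem x h =>
      obtain ⟨φ, rfl⟩ := h
      rw [laplacian, sum_inner, PiLp.inner_apply, ← Finset.sum_add_distrib]
      refine Finset.sum_eq_zero fun i _ => ?_
      have hw := w.2.1.2 i i φ
      have e1 : ⟪(w : Jet2 Ω).snd (i, i), (testJet φ).fst⟫
          = ∫ x in (Ω : Set E3), (w : Jet2 Ω).snd (i, i) x * φ x := by
        rw [inner_L2]
        refine integral_congr_ae ?_
        filter_upwards [(testFunction_memLp φ).coeFn_toLp] with x hx
        exact congrArg _ hx
      have e2 : ⟪grad (toH10 w) i, (testJet φ).snd i⟫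
          = ∫ x in (Ω : Set E3), (w : Jet2 Ω).fst.snd i x * partialDeriv i φ x := by
        rw [inner_L2]
        refine integral_congr_ae ?_
        filter_upwards [(partialDeriv_memLp i φ).coeFn_toLp] with x hx
        exact congrArg _ hx
      rw [e1, e2, hw]
      ring
    | zero => simp
    | add x y _ _ hx hy =>
      rw [WithLp.add_fst, WithLp.add_snd, inner_add_right, inner_add_right]
      linarith
    | smul c x _ hx =>
      rw [WithLp.smul_fst, WithLp.smul_snd, inner_smul_right, inner_smul_right, ← mul_add, hx,
        mul_zero]
  obtain ⟨x, hx, hlim⟩ := exists_seq_span_tendsto v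
  have hc : Continuous fun y : H10 Ω => ⟪laplacian w, fn y⟫ + ⟪grad (toH10 w), grad y⟫ :=
    (continuous_const.inner continuous_fn).add (continuous_const.inner continuous_grad)
  have h0 : ⟪laplacian w, fn v⟫ + ⟪grad (toH10 w), grad v⟫ = 0 :=
    tendsto_nhds_unique (((hc.tendsto v).comp hlim).congr fun n => htest _ (hx n))
      tendsto_const_nhds
  linarith

/-! ### Ordinary differential inequalities -/

/-- The concavity argument: a positive increasing function with `F F'' ≥ (3/2) F'²` blows up in
finite time. -/
theorem not_global_of_concavity {F F' F'' : ℝ → ℝ} {t₀ : ℝ}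
    (hF : ∀ t, t₀ ≤ t → HasDerivAt F (F' t) t) (hF' : ∀ t, t₀ ≤ t → HasDerivAt F' (F'' t) t)
    (hpos : ∀ t, t₀ ≤ t → 0 < F t) (hpos' : ∀ t, t₀ ≤ t → 0 < F' t)
    (hconc : ∀ t, t₀ ≤ t → 3 / 2 * F' t ^ 2 ≤ F t * F'' t) : False := by
  have hint : interior (Ici t₀) ⊆ Ici t₀ := interior_subset
  -- `F'²/F³` is four times the square of the derivative of `F^(-1/2)`; its derivative has the sign
  -- of `F F'' - (3/2) F'²`.
  have hmono : MonotoneOn (fun t => F' t ^ 2 / F t ^ 3) (Ici t₀) := by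
    have hd : ∀ t, t₀ ≤ t → HasDerivAt (fun t => F' t ^ 2 / F t ^ 3)
        ((2 * F' t * F'' t * F t ^ 3 - F' t ^ 2 * (3 * F t ^ 2 * F' t)) / (F t ^ 3) ^ 2) t := by
      intro t ht
      have h := ((hF' t ht).pow 2).div ((hF t ht).pow 3) (pow_pos (hpos t ht) 3).ne'
      refine h.congr_deriv ?_
      simp
    refine monotoneOn_of_deriv_nonneg (convex_Ici t₀)
      (fun t ht => (hd t ht).continuousAt.continuousWithinAt)
      (fun t ht => (hd t (hint ht)).differentiableAt.differentiableWithinAt) fun t ht => ?_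
    have ht := hint ht
    rw [(hd t ht).deriv]
    refine div_nonneg ?_ (by positivity)
    have h1 := hpos t ht
    have h2 := hpos' t ht
    have h3 := hconc t ht
    have : 0 ≤ 2 * F' t * F t ^ 2 * (F t * F'' t - 3 / 2 * F' t ^ 2) :=
      mul_nonneg (by positivity) (by linarith)
    linarith
  set κ := F' t₀ ^ 2 / F t₀ ^ 3 with hκ
  have hκ0 : 0 < κ := div_pos (pow_pos (hpos' t₀ le_rfl) 2) (pow_pos (hpos t₀ le_rfl) 3)
  have hderiv : ∀ t, t₀ ≤ t → HasDerivAt (fun t => 1 / √(F t))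
      (-(F' t / (2 * √(F t))) / √(F t) ^ 2) t := by
    intro t ht
    have h := (hasDerivAt_const t (1 : ℝ)).div ((hF t ht).sqrt (hpos t ht).ne')
      (Real.sqrt_pos.2 (hpos t ht)).ne'
    refine h.congr_deriv ?_
    simp
  have hbound : ∀ t, t₀ ≤ t → -(F' t / (2 * √(F t))) / √(F t) ^ 2 ≤ -(√κ / 2) := by
    intro t ht
    have h1 := hpos t ht
    have hs : 0 < √(F t) := Real.sqrt_pos.2 h1
    have h2 : κ ≤ F' t ^ 2 / F t ^ 3 := hmono (mem_Ici.2 le_rfl) ht ht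
    have h3 : √κ ≤ F' t / √(F t) ^ 3 := by
      rw [Real.sqrt_le_left (div_nonneg (hpos' t ht).le (by positivity)), div_pow, ← pow_mul,
        show 3 * 2 = 2 * 3 from rfl, pow_mul, Real.sq_sqrt h1.le]
      exact h2
    have e : -(F' t / (2 * √(F t))) / √(F t) ^ 2 = -((F' t / √(F t) ^ 3) / 2) := by
      field_simp
    rw [e]
    linarith
  have hs0 : 0 < √κ := Real.sqrt_pos.2 hκ0
  -- The time at which a line of slope `-√κ/2` starting from `F(t₀)^(-1/2)` reaches zero.
  set t := t₀ + 2 / √κ * (1 / √(F t₀)) with ht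
  have hs1 : 0 < 1 / √(F t₀) := one_div_pos.2 (Real.sqrt_pos.2 (hpos t₀ le_rfl))
  have htt : t₀ < t := by
    have : 0 < 2 / √κ * (1 / √(F t₀)) := by positivity
    linarith
  obtain ⟨c, hc, hslope⟩ := exists_hasDerivAt_eq_slope (fun t => 1 / √(F t)) _ htt
    (fun s hs => (hderiv s hs.1).continuousAt.continuousWithinAt)
    (fun s hs => hderiv s hs.1.le)
  have hb := hbound c hc.1.le
  rw [hslope, div_le_iff₀ (sub_pos.2 htt)] at hb
  have : -(√κ / 2) * (t - t₀) = -(1 / √(F t₀)) := by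
    rw [ht]
    field_simp
    ring
  have : 0 < 1 / √(F t) := one_div_pos.2 (Real.sqrt_pos.2 (hpos t htt.le))
  linarith

/-- A function whose derivative stays above a positive constant is eventually positive. -/
theorem exists_pos_of_deriv_ge {f f' : ℝ → ℝ} {c : ℝ} (hc : 0 < c)
    (hf : ∀ t, 0 < t → HasDerivAt f (f' t) t) (hbound : ∀ t, 0 < t → c ≤ f' t) :
    ∃ t₀, 0 < t₀ ∧ ∀ t, t₀ ≤ t → 0 < f t := by
  -- The mean value theorem is applied from time `1`, since nothing is assumed about `f` at `0`.
  refine ⟨2 + |f 1| / c, by positivity, fun t ht => ?_⟩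
  have h0 : 0 ≤ |f 1| / c := by positivity
  have h1t : 1 < t := by linarith
  obtain ⟨s, hs, hslope⟩ := exists_hasDerivAt_eq_slope f f' h1t
    (fun s hs => (hf s (by linarith [hs.1])).continuousAt.continuousWithinAt)
    (fun s hs => hf s (by linarith [hs.1]))
  have hb := hbound s (by linarith [hs.1])
  rw [hslope, le_div_iff₀ (by linarith)] at hb
  have : c * (1 + |f 1| / c) ≤ c * (t - 1) := by gcongr; linarith
  have e : c * (1 + |f 1| / c) = c + |f 1| := by field_simp
  linarith [neg_abs_le (f 1)]

/-- A continuous function on `[0, t]` which is positive at `0` and whose zeros are excluded is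
positive. -/
theorem pos_of_no_zero {f : ℝ → ℝ} {t : ℝ} (ht : 0 ≤ t) (hf : ContinuousOn f (Icc 0 t))
    (h0 : 0 < f 0)
    (hz : ∀ s ∈ Ioc 0 t, (∀ r ∈ Ico 0 s, 0 < f r) → f s ≠ 0) : 0 < f t := by
  by_contra! hneg
  -- The infimum of `A` is the first exit time; `f` vanishes there by the intermediate value
  -- theorem.
  set A := {s ∈ Icc 0 t | f s ≤ 0} with hA
  have hAc : IsClosed A := by
    have := hf.preimage_isClosed_of_isClosed isClosed_Icc (isClosed_Iic (a := (0 : ℝ)))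
    exact this
  have hAne : A.Nonempty := ⟨t, ⟨ht, le_rfl⟩, hneg⟩
  have hbdd : BddBelow A := ⟨0, fun s hs => hs.1.1⟩
  have hs := hAc.csInf_mem hAne hbdd
  set s := sInf A with hsdef
  have hbefore : ∀ r ∈ Ico 0 s, 0 < f r := by
    intro r hr
    by_contra! h
    exact absurd (csInf_le hbdd (show r ∈ A from ⟨⟨hr.1, hr.2.le.trans hs.1.2⟩, h⟩))
      (not_le.2 hr.2)
  have hs0 : 0 < s := by
    refine lt_of_le_of_ne hs.1.1 fun h => ?_
    have := hs.2
    rw [← h] at this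
    linarith
  have hmem : (0 : ℝ) ∈ f '' Icc 0 s := by
    have hsub : Icc 0 s ⊆ Icc 0 t := Icc_subset_Icc_right hs.1.2
    exact intermediate_value_Icc' hs0.le (hf.mono hsub) ⟨hs.2, h0.le⟩
  obtain ⟨r, hr, hr0⟩ := hmem
  have hrs : r = s := by
    by_contra hne
    exact absurd hr0 (hbefore r ⟨hr.1, lt_of_le_of_ne hr.2 hne⟩).ne'
  rw [hrs] at hr0
  exact hz s ⟨hs0, hs.1.2⟩ hbefore hr0

/-- If `F'' ≥ k (F - m)` with `k ≥ 0`, then `F' > 0` and `F > m` persist. -/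
theorem deriv_pos_of_second_deriv_ge {F F' F'' : ℝ → ℝ} {k m : ℝ} (hk : 0 ≤ k)
    (hcont : ContinuousOn F (Ici 0)) (hcont' : ContinuousOn F' (Ici 0))
    (hF : ∀ t, 0 < t → HasDerivAt F (F' t) t) (hF' : ∀ t, 0 < t → HasDerivAt F' (F'' t) t)
    (hbound : ∀ t, 0 < t → k * (F t - m) ≤ F'' t) (h0 : m < F 0) (h0' : 0 < F' 0) :
    ∀ t, 0 ≤ t → 0 < F' t ∧ F 0 ≤ F t := by
  have hsub : ∀ s : ℝ, Icc 0 s ⊆ Ici 0 := fun s r hr => hr.1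
  have hmono : ∀ s, (∀ r ∈ Ico 0 s, 0 < F' r) → MonotoneOn F (Icc 0 s) := by
    intro s hs
    refine monotoneOn_of_deriv_nonneg (convex_Icc 0 s) (hcont.mono (hsub s)) ?_ ?_
    · rw [interior_Icc]
      exact fun r hr => (hF r hr.1).differentiableAt.differentiableWithinAt
    · rw [interior_Icc]
      intro r hr
      rw [(hF r hr.1).deriv]
      exact (hs r ⟨hr.1.le, hr.2⟩).le
  have hpos : ∀ t, 0 ≤ t → 0 < F' t := by
    intro t ht
    refine pos_of_no_zero ht (hcont'.mono (hsub t)) h0' fun s hs hbefore => ?_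
    -- Before a first zero `s` of `F'`, `F` increases, so `F ≥ F 0 > m` and `F'' ≥ 0`; hence `F' s ≥
    -- F' 0 > 0`.
    have hm := hmono s hbefore
    have hm' : MonotoneOn F' (Icc 0 s) := by
      refine monotoneOn_of_deriv_nonneg (convex_Icc 0 s) (hcont'.mono (hsub s)) ?_ ?_
      · rw [interior_Icc]
        exact fun r hr => (hF' r hr.1).differentiableAt.differentiableWithinAt
      · rw [interior_Icc]
        intro r hr
        rw [(hF' r hr.1).deriv]
        refine le_trans (mul_nonneg hk ?_) (hbound r hr.1)
        linarith [hm ⟨le_rfl, hs.1.le⟩ ⟨hr.1.le, hr.2.le⟩ hr.1.le]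
    exact (h0'.trans_le (hm' ⟨le_rfl, hs.1.le⟩ ⟨hs.1.le, le_rfl⟩ hs.1.le)).ne'
  exact fun t ht => ⟨hpos t ht, hmono t (fun r hr => hpos r hr.1) ⟨le_rfl, ht⟩ ⟨ht, le_rfl⟩ ht⟩

variable {a b lam : ℝ}

/-! ### The potential well -/

theorem bZero_pos (hb : 0 < b) (hlam : lam < b * lambda1 Ω) : 0 < bZero Ω b lam := by
  unfold bZero
  split_ifs with h
  -- Here `0 ≤ λ < bλ₁` already forces `λ₁ > 0`.
  · have h1 : 0 < lambda1 Ω := pos_of_mul_pos_right (h.trans_lt hlam) hb.le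
    rw [sub_pos, div_lt_iff₀ h1]
    exact hlam
  · exact hb

theorem bZero_mul_le (hb : 0 < b) (hlam : lam < b * lambda1 Ω) (w : H10 Ω) :
    bZero Ω b lam * ‖grad w‖ ^ 2 ≤ b * ‖grad w‖ ^ 2 - lam * ‖fn w‖ ^ 2 := by
  unfold bZero
  split_ifs with h
  · have h1 : 0 < lambda1 Ω := pos_of_mul_pos_right (h.trans_lt hlam) hb.le
    have h2 : lam / lambda1 Ω * (lambda1 Ω * ‖fn w‖ ^ 2) ≤ lam / lambda1 Ω * ‖grad w‖ ^ 2 := by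
      gcongr
      exact lambda1_mul_le w
    have e : lam / lambda1 Ω * (lambda1 Ω * ‖fn w‖ ^ 2) = lam * ‖fn w‖ ^ 2 := by field_simp
    linarith
  · nlinarith [sq_nonneg ‖fn w‖]

theorem four_mul_potential (w : H10 Ω) :
    4 * potential a b lam w = nehari a b lam w + (b * ‖grad w‖ ^ 2 - lam * ‖fn w‖ ^ 2) := by
  unfold potential nehari
  ring

/-- With `1 / 0 = 0`, the condition `0 < a < 1/Λ` itself rules out `Λ = 0`; every use of the Sobolev
inequality rests on this. -/
theorem capLambda_pos (ha : 0 < a) (ha' : a < 1 / capLambda Ω) : 0 < capLambda Ω :=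
  one_div_pos.1 (ha.trans ha')

theorem one_sub_mul_capLambda_pos (ha : 0 < a) (ha' : a < 1 / capLambda Ω) :
    0 < 1 - a * capLambda Ω := by
  rw [lt_div_iff₀ (capLambda_pos ha ha')] at ha'
  linarith

theorem capLambda_mul_quartic_le (hL : 0 < capLambda Ω) (w : H10 Ω) :
    capLambda Ω * ((∫ x in (Ω : Set E3), |fn w x| ^ 4) - a * ‖grad w‖ ^ 4)
      ≤ (1 - a * capLambda Ω) * ‖grad w‖ ^ 4 := by
  linarith [capLambda_mul_integral_le hL w]

/-- With `G = ‖∇w‖₂²`, `I(w) < 0` gives `b₀G < ‖w‖₄⁴ - aG² ≤ (1/Λ - a)G²`, and strictness excludes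
`G = 0`. -/
theorem lt_norm_grad_sq_of_nehari_neg (ha : 0 < a) (ha' : a < 1 / capLambda Ω) (hb : 0 < b)
    (hlam : lam < b * lambda1 Ω) {w : H10 Ω} (hw : nehari a b lam w < 0) :
    bZero Ω b lam * capLambda Ω / (1 - a * capLambda Ω) < ‖grad w‖ ^ 2 := by
  have hL := capLambda_pos ha ha'
  have h1 := bZero_mul_le hb hlam w
  have h2 := capLambda_mul_quartic_le (a := a) hL w
  unfold nehari at hw
  rw [div_lt_iff₀ (one_sub_mul_capLambda_pos ha ha')]
  have h3 : capLambda Ω * (bZero Ω b lam * ‖grad w‖ ^ 2)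
      < capLambda Ω * ((∫ x in (Ω : Set E3), |fn w x| ^ 4) - a * ‖grad w‖ ^ 4) := by
    gcongr
    linarith
  have h4 : 0 ≤ ‖grad w‖ ^ 2 := sq_nonneg _
  by_contra! h
  nlinarith [mul_le_mul_of_nonneg_left h h4]

/-- The same comparison for `J`; the factor `2` is the ratio of the coefficients `1/2` and `1/4`. -/
theorem le_norm_grad_sq_of_potential_nonpos (ha : 0 < a) (ha' : a < 1 / capLambda Ω)
    (hb : 0 < b) (hlam : lam < b * lambda1 Ω) {w : H10 Ω} (hw : potential a b lam w ≤ 0)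
    (hw0 : 0 < ‖grad w‖) :
    2 * bZero Ω b lam * capLambda Ω / (1 - a * capLambda Ω) ≤ ‖grad w‖ ^ 2 := by
  have hL := capLambda_pos ha ha'
  have h1 := bZero_mul_le hb hlam w
  have h2 := capLambda_mul_quartic_le (a := a) hL w
  unfold potential at hw
  rw [div_le_iff₀ (one_sub_mul_capLambda_pos ha ha')]
  have h3 : capLambda Ω * (2 * (bZero Ω b lam * ‖grad w‖ ^ 2))
      ≤ capLambda Ω * ((∫ x in (Ω : Set E3), |fn w x| ^ 4) - a * ‖grad w‖ ^ 4) := by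
    gcongr
    linarith
  have h4 : 0 < ‖grad w‖ ^ 2 := by positivity
  by_contra! h
  nlinarith [mul_lt_mul_of_pos_left h h4]

theorem bddBelow_potential_nehariSet (hb : 0 < b) (hlam : lam < b * lambda1 Ω) :
    BddBelow (potential a b lam '' nehariSet Ω a b lam) := by
  refine ⟨0, ?_⟩
  rintro _ ⟨w, ⟨-, hw⟩, rfl⟩
  have h1 := four_mul_potential (a := a) (b := b) (lam := lam) w
  have h2 := bZero_mul_le hb hlam w
  have h3 := mul_nonneg (bZero_pos hb hlam).le (sq_nonneg ‖grad w‖)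
  linarith

theorem integral_abs_smul_pow_four (s : ℝ) (w : H10 Ω) :
    ∫ x in (Ω : Set E3), |fn (s • w) x| ^ 4 = s ^ 4 * ∫ x in (Ω : Set E3), |fn w x| ^ 4 := by
  rw [← integral_const_mul]
  refine integral_congr_ae ?_
  rw [fn_smul]
  filter_upwards [Lp.coeFn_smul s (fn w)] with x hx
  rw [hx, Pi.smul_apply, smul_eq_mul, abs_mul, mul_pow, Even.pow_abs ⟨2, rfl⟩ s]

/-- Scaling a point of `N₃⁻` down to the Nehari manifold bounds the quadratic part from below. -/
theorem four_mul_depth_le (ha : 0 < a) (ha' : a < 1 / capLambda Ω) (hb : 0 < b)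
    (hlam : lam < b * lambda1 Ω) {w : H10 Ω} (hw : nehari a b lam w < 0) :
    4 * depth Ω a b lam ≤ b * ‖grad w‖ ^ 2 - lam * ‖fn w‖ ^ 2 := by
  have hgrad : 0 < ‖grad w‖ ^ 2 := by
    refine lt_of_le_of_lt ?_ (lt_norm_grad_sq_of_nehari_neg ha ha' hb hlam hw)
    have h1 := bZero_pos hb hlam
    have h2 := capLambda_pos ha ha'
    have h3 := one_sub_mul_capLambda_pos ha ha'
    positivity
  set B := b * ‖grad w‖ ^ 2 - lam * ‖fn w‖ ^ 2 with hB
  set A := (∫ x in (Ω : Set E3), |fn w x| ^ 4) - a * ‖grad w‖ ^ 4 with hA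
  have hB0 : 0 < B :=
    (mul_pos (bZero_pos hb hlam) hgrad).trans_le (bZero_mul_le hb hlam w)
  have hBA : B < A := by
    unfold nehari at hw
    linarith
  have hA0 : 0 < A := hB0.trans hBA
  -- The nonzero root of `I(s w) = s²B - s⁴A`. There `4J(s w) = s²B`, which is at most `B` because
  -- `B < A`.
  set s := √(B / A) with hs
  have hs2 : s ^ 2 = B / A := Real.sq_sqrt (by positivity)
  have hs0 : 0 < s := by positivity
  have hquad : b * ‖grad (s • w)‖ ^ 2 - lam * ‖fn (s • w)‖ ^ 2 = s ^ 2 * B := by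
    rw [grad_smul, fn_smul, norm_smul, norm_smul, Real.norm_of_nonneg hs0.le, hB]
    ring
  have hneh : nehari a b lam (s • w) = 0 := by
    have e : nehari a b lam (s • w) = s ^ 2 * B - (s ^ 2) ^ 2 * A := by
      rw [← hquad]
      unfold nehari
      rw [integral_abs_smul_pow_four, hA, grad_smul, norm_smul, Real.norm_of_nonneg hs0.le]
      ring
    rw [e, hs2]
    field_simp
    ring
  have hmem : s • w ∈ nehariSet Ω a b lam := by
    refine ⟨smul_ne_zero hs0.ne' ?_, hneh⟩
    rintro rfl
    rw [← gradL_apply, map_zero] at hgrad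
    simp at hgrad
  have hle : depth Ω a b lam ≤ potential a b lam (s • w) :=
    csInf_le (bddBelow_potential_nehariSet hb hlam) ⟨_, hmem, rfl⟩
  have h4 := four_mul_potential (a := a) (b := b) (lam := lam) (s • w)
  rw [hneh, hquad, hs2] at h4
  have : B / A * B ≤ 1 * B := by
    gcongr
    rw [div_le_one hA0]
    exact hBA.le
  linarith

/-! ### Continuity and differentiation of the functionals -/

theorem continuous_integral_abs_pow_four (hL : 0 < capLambda Ω) :
    Continuous fun w : H10 Ω => ∫ x in (Ω : Set E3), |fn w x| ^ 4 := by
  simp_rw [integral_abs_pow_four hL]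
  fun_prop

theorem continuous_potential (hL : 0 < capLambda Ω) :
    Continuous (potential (Ω := Ω) a b lam) := by
  have h1 := continuous_integral_abs_pow_four hL
  have h2 := continuous_fn (Ω := Ω)
  have h3 := continuous_grad (Ω := Ω)
  unfold potential
  fun_prop

theorem continuous_nehari (hL : 0 < capLambda Ω) : Continuous (nehari (Ω := Ω) a b lam) := by
  have h1 := continuous_integral_abs_pow_four hL
  have h2 := continuous_fn (Ω := Ω)
  have h3 := continuous_grad (Ω := Ω)
  unfold nehari
  fun_prop

theorem _root_.ContinuousLinearMap.hasDerivAt_apply_apply_self {E F : Type*}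
    [NormedAddCommGroup E] [NormedSpace ℝ E] [NormedAddCommGroup F] [NormedSpace ℝ F]
    (B : E →L[ℝ] E →L[ℝ] F) {w : ℝ → E} {w' : E} {t : ℝ} (hw : HasDerivAt w w' t) :
    HasDerivAt (fun s => B (w s) (w s)) (B w' (w t) + B (w t) w') t :=
  (B.hasFDerivAt.comp_hasDerivAt t hw).clm_apply hw

theorem hasDerivAt_mulL_self (hL : 0 < capLambda Ω) {w : ℝ → H10 Ω} {w' : H10 Ω} {t : ℝ}
    (hw : HasDerivAt w w' t) :
    HasDerivAt (fun s => mulL hL (w s) (w s)) ((2 : ℝ) • mulL hL (w t) w') t := by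
  have h := (mulL hL).hasDerivAt_apply_apply_self hw
  rwa [mulL_comm hL w', ← two_smul ℝ] at h

theorem hasDerivAt_norm_mulL_self_sq (hL : 0 < capLambda Ω) {w : ℝ → H10 Ω} {w' : H10 Ω} {t : ℝ}
    (hw : HasDerivAt w w' t) :
    HasDerivAt (fun s => ‖mulL hL (w s) (w s)‖ ^ 2)
      (4 * ⟪mulL hL (w t) (w t), mulL hL (w t) w'⟫) t := by
  refine (hasDerivAt_mulL_self hL hw).norm_sq.congr_deriv ?_
  rw [real_inner_smul_right]
  ring

/-! ### The time interval -/

variable {T : EReal}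

theorem ordConnected_timeInterval : (timeInterval T).OrdConnected :=
  ⟨fun _ hx _ hy _ hz =>
    ⟨hx.1.trans hz.1, (EReal.coe_le_coe_iff.2 hz.2).trans_lt hy.2⟩⟩

theorem Icc_subset_timeInterval {t : ℝ} (ht : t ∈ timeInterval T) :
    Icc 0 t ⊆ timeInterval T := fun _ hs =>
  ⟨hs.1, (EReal.coe_le_coe_iff.2 hs.2).trans_lt ht.2⟩

theorem timeInterval_mem_nhds {t : ℝ} (ht : t ∈ timeInterval T) (h0 : 0 < t) :
    timeInterval T ∈ 𝓝 t := by
  have h1 : IsOpen {s : ℝ | (s : EReal) < T} :=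
    isOpen_lt continuous_coe_real_ereal continuous_const
  filter_upwards [lt_mem_nhds h0, h1.mem_nhds ht.2] with s hs hs'
  exact ⟨le_of_lt hs, hs'⟩

theorem uniqueDiffOn_timeInterval (hT : 0 < T) : UniqueDiffOn ℝ (timeInterval T) := by
  obtain ⟨t, ht0, htT⟩ := EReal.lt_iff_exists_real_btwn.1 hT
  have ht : 0 < t := EReal.coe_pos.1 ht0
  refine uniqueDiffOn_convex ordConnected_timeInterval.convex ⟨t, ?_⟩
  exact mem_interior_iff_mem_nhds.2 (timeInterval_mem_nhds ⟨ht.le, htT⟩ ht)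

theorem timeInterval_top : timeInterval ⊤ = Ici 0 := by
  ext t
  exact ⟨fun h => h.1, fun h => ⟨h, EReal.coe_lt_top t⟩⟩

/-! ### Solutions -/

/-- The velocity of a solution, as a curve in `H¹₀(Ω)`. -/
def velocity (T : EReal) (u : ℝ → H2H10 Ω) (t : ℝ) : H10 Ω :=
  derivWithin (fun s => toH10 (u s)) (timeInterval T) t

/-- The acceleration of a solution, as a curve in `L²(Ω)`. -/
def acceleration (T : EReal) (u : ℝ → H2H10 Ω) (t : ℝ) : L2 Ω :=
  iteratedDerivWithin 2 (fun s => fn (toH10 (u s))) (timeInterval T) t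

/-- The energy of a solution at time `t`. -/
def energy (a b lam : ℝ) (T : EReal) (u : ℝ → H2H10 Ω) (t : ℝ) : ℝ :=
  initialEnergy a b lam (toH10 (u t)) (velocity T u t)

namespace IsSolution

variable {u0 : H2H10 Ω} {u1 : H10 Ω} {u : ℝ → H2H10 Ω}

theorem hasDerivWithinAt (hu : IsSolution a b lam u0 u1 T u) {t : ℝ} (ht : t ∈ timeInterval T) :
    HasDerivWithinAt (fun s => toH10 (u s)) (velocity T u t) (timeInterval T) t :=
  (hu.contDiffOn_one.differentiableOn (by simp) t ht).hasDerivWithinAt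

theorem hasDerivAt (hu : IsSolution a b lam u0 u1 T u) {t : ℝ} (ht : t ∈ timeInterval T)
    (h0 : 0 < t) : HasDerivAt (fun s => toH10 (u s)) (velocity T u t) t :=
  (hu.hasDerivWithinAt ht).hasDerivAt (timeInterval_mem_nhds ht h0)

theorem hasDerivAt_fn (hu : IsSolution a b lam u0 u1 T u) {t : ℝ} (ht : t ∈ timeInterval T)
    (h0 : 0 < t) : HasDerivAt (fun s => fn (toH10 (u s))) (fn (velocity T u t)) t :=
  (fnL Ω).hasFDerivAt.comp_hasDerivAt t (hu.hasDerivAt ht h0)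

theorem hasDerivAt_grad (hu : IsSolution a b lam u0 u1 T u) {t : ℝ} (ht : t ∈ timeInterval T)
    (h0 : 0 < t) : HasDerivAt (fun s => grad (toH10 (u s))) (grad (velocity T u t)) t :=
  (gradL Ω).hasFDerivAt.comp_hasDerivAt t (hu.hasDerivAt ht h0)

theorem fn_velocity (hu : IsSolution a b lam u0 u1 T u) {t : ℝ} (ht : t ∈ timeInterval T) :
    fn (velocity T u t) = derivWithin (fun s => fn (toH10 (u s))) (timeInterval T) t :=
  ((fnL Ω).hasFDerivAt.comp_hasDerivWithinAt t (hu.hasDerivWithinAt ht)).derivWithin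
    (uniqueDiffOn_timeInterval hu.pos t ht) |>.symm

theorem hasDerivAt_fn_velocity (hu : IsSolution a b lam u0 u1 T u) {t : ℝ}
    (ht : t ∈ timeInterval T) (h0 : 0 < t) :
    HasDerivAt (fun s => fn (velocity T u s)) (acceleration T u t) t := by
  have hd := hu.contDiffOn_two.differentiableOn_iteratedDerivWithin (m := 1) (by norm_num)
    (uniqueDiffOn_timeInterval hu.pos) t ht
  have h := hd.hasDerivWithinAt
  rw [← iteratedDerivWithin_succ] at h
  have h' := h.hasDerivAt (timeInterval_mem_nhds ht h0)
  refine h'.congr_of_eventuallyEq ?_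
  filter_upwards [timeInterval_mem_nhds ht h0] with s hs
  rw [hu.fn_velocity hs, iteratedDerivWithin_one]

theorem continuousOn_toH10 (hu : IsSolution a b lam u0 u1 T u) :
    ContinuousOn (fun s => toH10 (u s)) (timeInterval T) :=
  hu.contDiffOn_one.continuousOn

theorem continuousOn_velocity (hu : IsSolution a b lam u0 u1 T u) :
    ContinuousOn (velocity T u) (timeInterval T) :=
  hu.contDiffOn_one.continuousOn_derivWithin (uniqueDiffOn_timeInterval hu.pos) le_rfl

/-- The equation tested with a function of `H¹₀(Ω)`. -/
theorem weak_equation (hu : IsSolution a b lam u0 u1 T u) (hL : 0 < capLambda Ω) {t : ℝ}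
    (ht : t ∈ timeInterval T) (h0 : 0 < t) (v : H10 Ω) :
    ⟪acceleration T u t, fn v⟫
        + (a * ‖grad (toH10 (u t))‖ ^ 2 + b) * ⟪grad (toH10 (u t)), grad v⟫
      = lam * ⟪fn (toH10 (u t)), fn v⟫
        + ⟪mulL hL (toH10 (u t)) (toH10 (u t)), mulL hL (toH10 (u t)) v⟫ := by
  set w := toH10 (u t) with hw
  set c := a * ‖grad w‖ ^ 2 + b with hc
  -- The cubic term is paired with `v` through `u³v = (u·u)(u·v)`, a product of two `L²` functions.
  have key : ⟪acceleration T u t - c • laplacian (u t) - lam • fn w, fn v⟫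
      = ⟪mulL hL w w, mulL hL w v⟫ := by
    rw [inner_L2, inner_L2]
    refine integral_congr_ae ?_
    filter_upwards [hu.equation t ht h0, coeFn_mulL hL w w, coeFn_mulL hL w v,
      Lp.coeFn_sub (acceleration T u t - c • laplacian (u t)) (lam • fn w),
      Lp.coeFn_sub (acceleration T u t) (c • laplacian (u t)),
      Lp.coeFn_smul c (laplacian (u t)), Lp.coeFn_smul lam (fn w)] with x h1 h2 h3 h4 h5 h6 h7
    rw [h2, h3, h4, Pi.sub_apply, h5, Pi.sub_apply, h6, h7, Pi.smul_apply, Pi.smul_apply,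
      smul_eq_mul, smul_eq_mul]
    change acceleration T u t x - c * laplacian (u t) x
      = lam * fn w x + |fn w x| ^ 2 * fn w x at h1
    rw [h1, sq_abs]
    ring
  rw [inner_sub_left, inner_sub_left, real_inner_smul_left, real_inner_smul_left,
    inner_laplacian, ← hw] at key
  linarith

/-! ### Conservation of energy -/

theorem energy_zero (hu : IsSolution a b lam u0 u1 T u) :
    energy a b lam T u 0 = initialEnergy a b lam (toH10 u0) u1 := by
  unfold energy velocity
  rw [hu.initial_position, hu.initial_velocity]

/-- The equation is tested with `u_t`, which is admissible because `u_t` takes values in `H¹₀`. -/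
theorem hasDerivAt_energy (hu : IsSolution a b lam u0 u1 T u) (hL : 0 < capLambda Ω) {t : ℝ}
    (ht : t ∈ timeInterval T) (h0 : 0 < t) : HasDerivAt (energy a b lam T u) 0 t := by
  have e : energy a b lam T u = fun s => 1 / 2 * ‖fn (velocity T u s)‖ ^ 2
      + (a / 4 * (‖grad (toH10 (u s))‖ ^ 2) ^ 2 + b / 2 * ‖grad (toH10 (u s))‖ ^ 2
        - lam / 2 * ‖fn (toH10 (u s))‖ ^ 2
        - 1 / 4 * ‖mulL hL (toH10 (u s)) (toH10 (u s))‖ ^ 2) := by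
    funext s
    unfold energy initialEnergy potential
    rw [integral_abs_pow_four hL]
    ring
  rw [e]
  have hG := (hu.hasDerivAt_grad ht h0).norm_sq
  have hU := (hu.hasDerivAt_fn ht h0).norm_sq
  have hV := (hu.hasDerivAt_fn_velocity ht h0).norm_sq
  have hQ := hasDerivAt_norm_mulL_self_sq hL (hu.hasDerivAt ht h0)
  have h := (hV.const_mul (1 / 2)).add
    (((((hG.pow 2).const_mul (a / 4)).add (hG.const_mul (b / 2))).sub
      (hU.const_mul (lam / 2))).sub (hQ.const_mul (1 / 4)))
  refine h.congr_deriv ?_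
  have hw := hu.weak_equation hL ht h0 (velocity T u t)
  rw [real_inner_comm] at hw
  simp only [Nat.cast_ofNat, pow_one, Nat.add_one_sub_one]
  linear_combination hw

theorem energy_eq (hu : IsSolution a b lam u0 u1 T u) (hL : 0 < capLambda Ω) {t : ℝ}
    (ht : t ∈ timeInterval T) :
    energy a b lam T u t = initialEnergy a b lam (toH10 u0) u1 := by
  rw [← hu.energy_zero]
  rcases ht.1.eq_or_lt with h | h
  · rw [← h]
  -- The energy is differentiated only at positive times; continuity reaches the endpoint `0`.
  have hcont : ContinuousOn (energy a b lam T u) (timeInterval T) :=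
    ((continuous_fn.comp_continuousOn hu.continuousOn_velocity).norm.pow 2).const_mul (1 / 2)
      |>.add ((continuous_potential hL).comp_continuousOn hu.continuousOn_toH10)
  obtain ⟨s, hs, hslope⟩ := exists_hasDerivAt_eq_slope (energy a b lam T u) (fun _ => 0) h
    (hcont.mono (Icc_subset_timeInterval ht))
    (fun s hs => hu.hasDerivAt_energy hL (Icc_subset_timeInterval ht ⟨hs.1.le, hs.2.le⟩) hs.1)
  rw [eq_comm, div_eq_zero_iff] at hslope
  rcases hslope with h' | h' <;> linarith

theorem potential_le (hu : IsSolution a b lam u0 u1 T u) (hL : 0 < capLambda Ω) {t : ℝ}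
    (ht : t ∈ timeInterval T) :
    potential a b lam (toH10 (u t)) ≤ initialEnergy a b lam (toH10 u0) u1 := by
  have h := hu.energy_eq hL ht
  unfold energy at h
  rw [initialEnergy] at h
  nlinarith [sq_nonneg ‖fn (velocity T u t)‖]

/-! ### Convexity of `‖u‖₂²` and exclusion of global solutions -/

theorem hasDerivAt_norm_sq (hu : IsSolution a b lam u0 u1 T u) {t : ℝ} (ht : t ∈ timeInterval T)
    (h0 : 0 < t) : HasDerivAt (fun s => ‖fn (toH10 (u s))‖ ^ 2)
      (2 * ⟪fn (toH10 (u t)), fn (velocity T u t)⟫) t :=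
  (hu.hasDerivAt_fn ht h0).norm_sq

/-- The second derivative of `‖u‖₂²`, in which the quartic terms are replaced using the
conservation of energy. -/
theorem hasDerivAt_inner_velocity (hu : IsSolution a b lam u0 u1 T u) (hL : 0 < capLambda Ω)
    {t : ℝ} (ht : t ∈ timeInterval T) (h0 : 0 < t) :
    HasDerivAt (fun s => 2 * ⟪fn (toH10 (u s)), fn (velocity T u s)⟫)
      (6 * ‖fn (velocity T u t)‖ ^ 2 - 8 * initialEnergy a b lam (toH10 u0) u1
        + 2 * (b * ‖grad (toH10 (u t))‖ ^ 2 - lam * ‖fn (toH10 (u t))‖ ^ 2)) t := by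
  have h := ((hu.hasDerivAt_fn ht h0).inner ℝ (hu.hasDerivAt_fn_velocity ht h0)).const_mul 2
  refine h.congr_deriv ?_
  have hw := hu.weak_equation hL ht h0 (toH10 (u t))
  have hE := hu.energy_eq hL ht
  unfold energy initialEnergy potential at hE
  rw [integral_abs_pow_four hL] at hE
  unfold initialEnergy potential
  simp only [real_inner_self_eq_norm_sq] at hw ⊢
  rw [real_inner_comm] at hw
  linear_combination 2 * hw - 8 * hE

theorem inner_sq_le (t : ℝ) :
    (2 * ⟪fn (toH10 (u t)), fn (velocity T u t)⟫) ^ 2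
      ≤ 4 * ‖fn (toH10 (u t))‖ ^ 2 * ‖fn (velocity T u t)‖ ^ 2 := by
  have h := abs_real_inner_le_norm (fn (toH10 (u t))) (fn (velocity T u t))
  have h2 := sq_le_sq' (by linarith [neg_abs_le ⟪fn (toH10 (u t)), fn (velocity T u t)⟫])
    ((le_abs_self _).trans h)
  rw [mul_pow] at h2
  linarith

/-- A global solution cannot have `(‖u‖₂²)' > 0` and `-8 E(0) + 2 (b ‖∇u‖₂² - λ ‖u‖₂²) ≥ 0` from
some time on. -/
theorem not_global (hu : IsSolution a b lam u0 u1 ⊤ u) (hL : 0 < capLambda Ω) {t₀ : ℝ}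
    (ht₀ : 0 < t₀)
    (hpos : ∀ t, t₀ ≤ t → 0 < 2 * ⟪fn (toH10 (u t)), fn (velocity ⊤ u t)⟫)
    (hB : ∀ t, t₀ ≤ t → 4 * initialEnergy a b lam (toH10 u0) u1
      ≤ b * ‖grad (toH10 (u t))‖ ^ 2 - lam * ‖fn (toH10 (u t))‖ ^ 2) : False := by
  have hmem : ∀ t, t₀ ≤ t → t ∈ timeInterval ⊤ := fun t ht =>
    ⟨ht₀.le.trans ht, EReal.coe_lt_top t⟩
  refine not_global_of_concavity
    (fun t ht => hu.hasDerivAt_norm_sq (hmem t ht) (ht₀.trans_le ht))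
    (fun t ht => hu.hasDerivAt_inner_velocity hL (hmem t ht) (ht₀.trans_le ht))
    (fun t ht => ?_) hpos (fun t ht => ?_)
  · have h := hpos t ht
    refine pow_pos (norm_pos_iff.2 fun h0 => ?_) 2
    rw [h0, inner_zero_left, mul_zero] at h
    exact lt_irrefl _ h
  -- `F'² ≤ 4F‖u_t‖₂²` and `F'' ≥ 6‖u_t‖₂²` give the constant `3/2 = 6/4`.
  · have h1 := inner_sq_le (T := ⊤) (u := u) t
    have h2 := mul_nonneg (sq_nonneg ‖fn (toH10 (u t))‖) (sub_nonneg.2 (hB t ht))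
    linarith

/-- The gap gives `F'' ≥ 2ε`, so `F'` eventually becomes positive whatever its initial sign. -/
theorem not_global_of_uniform_gap (hu : IsSolution a b lam u0 u1 ⊤ u) (hL : 0 < capLambda Ω)
    {ε : ℝ} (hε : 0 < ε)
    (hB : ∀ t, 0 < t → 4 * initialEnergy a b lam (toH10 u0) u1 + ε
      ≤ b * ‖grad (toH10 (u t))‖ ^ 2 - lam * ‖fn (toH10 (u t))‖ ^ 2) : False := by
  obtain ⟨t₀, ht₀, hpos⟩ := exists_pos_of_deriv_ge hε
    (fun t ht => hu.hasDerivAt_inner_velocity hL ⟨ht.le, EReal.coe_lt_top t⟩ ht)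
    (fun t ht => by nlinarith [hB t ht, sq_nonneg ‖fn (velocity ⊤ u t)‖])
  exact hu.not_global hL ht₀ hpos fun t ht => by linarith [hB t (ht₀.trans_le ht)]

/-- A solution with `(‖u‖₂²)' > 0` initially and `b ‖∇u‖₂² - λ ‖u‖₂² ≥ k ‖u‖₂²`, where
`4 E(0) ≤ k m` and `m < ‖u₀‖₂²`, is not global. -/
theorem not_global_of_inner_pos (hu : IsSolution a b lam u0 u1 ⊤ u) (hL : 0 < capLambda Ω)
    {k m : ℝ} (hk : 0 ≤ k) (hm : m < ‖fn (toH10 u0)‖ ^ 2)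
    (hE : 4 * initialEnergy a b lam (toH10 u0) u1 ≤ k * m)
    (hB : ∀ w : H10 Ω, k * ‖fn w‖ ^ 2 ≤ b * ‖grad w‖ ^ 2 - lam * ‖fn w‖ ^ 2)
    (h0 : 0 < ⟪fn (toH10 u0), fn u1⟫) : False := by
  have hcU := continuous_fn.comp_continuousOn hu.continuousOn_toH10
  have hcV := continuous_fn.comp_continuousOn hu.continuousOn_velocity
  rw [timeInterval_top] at hcU hcV
  -- `2B ≥ 2kF` and `8E(0) ≤ 2km` give `F'' ≥ 2k(F - m)`.
  have hpers := deriv_pos_of_second_deriv_ge (k := 2 * k) (m := m) (by positivity)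
    (F := fun s => ‖fn (toH10 (u s))‖ ^ 2)
    (F' := fun s => 2 * ⟪fn (toH10 (u s)), fn (velocity ⊤ u s)⟫)
    (hcU.norm.pow 2) ((hcU.inner hcV).const_mul 2)
    (fun t ht => hu.hasDerivAt_norm_sq ⟨ht.le, EReal.coe_lt_top t⟩ ht)
    (fun t ht => hu.hasDerivAt_inner_velocity hL ⟨ht.le, EReal.coe_lt_top t⟩ ht)
    (fun t _ => by nlinarith [hB (toH10 (u t)), sq_nonneg ‖fn (velocity ⊤ u t)‖])
    (by simpa only [hu.initial_position] using hm)
    (by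
      have e : velocity ⊤ u 0 = u1 := hu.initial_velocity
      simp only [hu.initial_position, e]
      linarith)
  refine hu.not_global hL one_pos (fun t ht => (hpers t (by linarith)).1) fun t ht => ?_
  have h1 : ‖fn (toH10 (u 0))‖ ^ 2 ≤ ‖fn (toH10 (u t))‖ ^ 2 := (hpers t (by linarith)).2
  rw [hu.initial_position] at h1
  have h2 := mul_le_mul_of_nonneg_left (hm.le.trans h1) hk
  linarith [hB (toH10 (u t))]

/-- The unstable set is invariant. -/
theorem nehari_neg (hu : IsSolution a b lam u0 u1 T u) (ha : 0 < a) (ha' : a < 1 / capLambda Ω)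
    (hb : 0 < b) (hlam : lam < b * lambda1 Ω)
    (hE : initialEnergy a b lam (toH10 u0) u1 < depth Ω a b lam)
    (h0 : nehari a b lam (toH10 u0) < 0) {t : ℝ} (ht : t ∈ timeInterval T) :
    nehari a b lam (toH10 (u t)) < 0 := by
  have hL := capLambda_pos ha ha'
  have hsub := Icc_subset_timeInterval ht
  refine neg_pos.1 (pos_of_no_zero (f := fun s => -nehari a b lam (toH10 (u s))) ht.1
    (((continuous_nehari hL).comp_continuousOn hu.continuousOn_toH10).neg.mono hsub) ?_ ?_)
  · rw [hu.initial_position]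
    linarith
  · intro s hs hbefore hzero
    have hsT : s ∈ timeInterval T := hsub ⟨hs.1.le, hs.2⟩
    -- A zero of `I` could a priori be the zero function. The gradient bound on `N₃⁻` survives the
    -- limit `r → s⁻`, so `u(s) ∈ N₃`, and `J(u(s)) ≥ d₃ > E(0)` is contradictory.
    have hgrad : bZero Ω b lam * capLambda Ω / (1 - a * capLambda Ω)
        ≤ ‖grad (toH10 (u s))‖ ^ 2 := by
      have hc := (hu.hasDerivAt_grad hsT hs.1).continuousAt.norm.pow 2
      refine ge_of_tendsto (hc.tendsto.mono_left (nhdsWithin_le_nhds (s := Iio s))) ?_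
      filter_upwards [Ioo_mem_nhdsLT hs.1] with r hr
      exact (lt_norm_grad_sq_of_nehari_neg ha ha' hb hlam
        (neg_pos.1 (hbefore r ⟨hr.1.le, hr.2⟩))).le
    have hpos : 0 < bZero Ω b lam * capLambda Ω / (1 - a * capLambda Ω) :=
      div_pos (mul_pos (bZero_pos hb hlam) hL) (one_sub_mul_capLambda_pos ha ha')
    have hmem : toH10 (u s) ∈ nehariSet Ω a b lam := by
      refine ⟨fun h => ?_, neg_eq_zero.1 hzero⟩
      rw [h, ← gradL_apply, map_zero, norm_zero] at hgrad
      linarith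
    have hle : depth Ω a b lam ≤ potential a b lam (toH10 (u s)) :=
      csInf_le (bddBelow_potential_nehariSet hb hlam) ⟨_, hmem, rfl⟩
    linarith [hu.potential_le hL hsT]

/-- If the gradient norm vanished for the first time at `s`, the threshold valid before `s` would
persist in the limit. -/
theorem norm_grad_sq_ge (hu : IsSolution a b lam u0 u1 T u) (ha : 0 < a)
    (ha' : a < 1 / capLambda Ω) (hb : 0 < b) (hlam : lam < b * lambda1 Ω)
    (hE : initialEnergy a b lam (toH10 u0) u1 ≤ 0) (h0 : 0 < ‖grad (toH10 u0)‖) {t : ℝ}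
    (ht : t ∈ timeInterval T) :
    2 * bZero Ω b lam * capLambda Ω / (1 - a * capLambda Ω) ≤ ‖grad (toH10 (u t))‖ ^ 2 := by
  have hL := capLambda_pos ha ha'
  have hsub := Icc_subset_timeInterval ht
  have hJ : ∀ s ∈ timeInterval T, potential a b lam (toH10 (u s)) ≤ 0 := fun s hs =>
    (hu.potential_le hL hs).trans hE
  refine le_norm_grad_sq_of_potential_nonpos ha ha' hb hlam (hJ t ht) ?_
  refine pos_of_no_zero (f := fun s => ‖grad (toH10 (u s))‖) ht.1
    ((continuous_grad.comp_continuousOn hu.continuousOn_toH10).norm.mono hsub)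
    (by simpa only [hu.initial_position] using h0) ?_
  intro s hs hbefore hzero
  have hsT : s ∈ timeInterval T := hsub ⟨hs.1.le, hs.2⟩
  have hgrad : 2 * bZero Ω b lam * capLambda Ω / (1 - a * capLambda Ω)
      ≤ ‖grad (toH10 (u s))‖ ^ 2 := by
    have hc := (hu.hasDerivAt_grad hsT hs.1).continuousAt.norm.pow 2
    refine ge_of_tendsto (hc.tendsto.mono_left (nhdsWithin_le_nhds (s := Iio s))) ?_
    filter_upwards [Ioo_mem_nhdsLT hs.1] with r hr
    exact le_norm_grad_sq_of_potential_nonpos ha ha' hb hlam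
      (hJ r (hsub ⟨hr.1.le, hr.2.le.trans hs.2⟩)) (hbefore r ⟨hr.1.le, hr.2⟩)
  have hpos : 0 < 2 * bZero Ω b lam * capLambda Ω / (1 - a * capLambda Ω) :=
    div_pos (mul_pos (mul_pos two_pos (bZero_pos hb hlam)) hL)
      (one_sub_mul_capLambda_pos ha ha')
  rw [hzero] at hgrad
  linarith

end IsSolution

end

end Kirchhoff

/-! ### The theorem -/

open Kirchhoff
theorem theorem2p6 (Ω : Opens E3) (hconn : IsConnected (Ω : Set E3))
    (hbdd : Bornology.IsBounded (Ω : Set E3)) (hsmooth : HasSmoothBoundary (Ω : Set E3))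
    (a b lam : ℝ) (ha : 0 < a) (ha' : a < 1 / capLambda Ω) (hb : 0 < b)
    (hlam : lam < b * lambda1 Ω)
    (hN : ∃ w : H2H10 Ω, toH10 w ∈ nehariSet Ω a b lam ∪ nehariMinus Ω a b lam)
    (u0 : H2H10 Ω) (u1 : H10 Ω) (T : EReal) (u : ℝ → H2H10 Ω)
    (hu : IsMaximalSolution a b lam u0 u1 T u) :
    ((initialEnergy a b lam (toH10 u0) u1 < 0 ∨
        (initialEnergy a b lam (toH10 u0) u1 = 0 ∧
          0 < ∫ x in (Ω : Set E3), fn (toH10 u0) x * fn u1 x) ∨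
        (0 < initialEnergy a b lam (toH10 u0) u1 ∧
          initialEnergy a b lam (toH10 u0) u1 < depth Ω a b lam ∧
          toH10 u0 ∈ unstableSet Ω a b lam) ∨
        (depth Ω a b lam ≤ initialEnergy a b lam (toH10 u0) u1 ∧
          0 < ∫ x in (Ω : Set E3), fn (toH10 u0) x * fn u1 x ∧
          4 / (bZero Ω b lam * lambda1 Ω) * initialEnergy a b lam (toH10 u0) u1
            < ‖fn (toH10 u0)‖ ^ 2)) →
      T < ⊤) ∧
    (initialEnergy a b lam (toH10 u0) u1 ≤ 0 → 0 < ‖grad (toH10 u0)‖ →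
      ∀ t ∈ timeInterval T,
        2 * bZero Ω b lam * capLambda Ω / (1 - a * capLambda Ω) ≤ ‖grad (toH10 (u t))‖ ^ 2) := by
  have hsol := hu.1
  have hL := capLambda_pos ha ha'
  have hb0 := bZero_pos hb hlam
  refine ⟨fun hcases => ?_, fun hE h0 t ht => hsol.norm_grad_sq_ge ha ha' hb hlam hE h0 ht⟩
  rw [lt_top_iff_ne_top]
  rintro rfl
  have hquad : ∀ w : H10 Ω, bZero Ω b lam * lambda1 Ω * ‖fn w‖ ^ 2
      ≤ b * ‖grad w‖ ^ 2 - lam * ‖fn w‖ ^ 2 := fun w => by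
    refine le_trans ?_ (bZero_mul_le hb hlam w)
    rw [mul_assoc]
    exact mul_le_mul_of_nonneg_left (lambda1_mul_le w) hb0.le
  have hquad0 : ∀ w : H10 Ω, 0 ≤ b * ‖grad w‖ ^ 2 - lam * ‖fn w‖ ^ 2 := fun w =>
    (mul_nonneg hb0.le (sq_nonneg _)).trans (bZero_mul_le hb hlam w)
  have hne : 0 < ∫ x in (Ω : Set E3), fn (toH10 u0) x * fn u1 x → fn (toH10 u0) ≠ 0 := by
    intro h h0
    rw [← inner_L2, h0, inner_zero_left] at h
    exact lt_irrefl _ h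
  rcases hcases with hE | ⟨hE, hpos⟩ | ⟨-, hE, hW⟩ | ⟨-, hpos, hlarge⟩
  · exact hsol.not_global_of_uniform_gap hL
      (ε := -(4 * initialEnergy a b lam (toH10 u0) u1)) (by linarith)
      fun t _ => by linarith [hquad0 (toH10 (u t))]
  -- With `k = m = 0`, the condition `m < ‖u₀‖₂²` says `u₀ ≠ 0`, which the positive inner product
  -- provides.
  · refine hsol.not_global_of_inner_pos hL (k := 0) (m := 0) le_rfl
      (pow_pos (norm_pos_iff.2 (hne hpos)) 2) (by rw [hE]; simp)
      (fun w => by simpa using hquad0 w) ?_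
    rwa [inner_L2]
  · refine hsol.not_global_of_uniform_gap hL
      (ε := 4 * (depth Ω a b lam - initialEnergy a b lam (toH10 u0) u1)) (by linarith)
      fun t ht => ?_
    have h := four_mul_depth_le ha ha' hb hlam
      (hsol.nehari_neg ha ha' hb hlam hE hW.2 (t := t) ⟨ht.le, EReal.coe_lt_top t⟩)
    linarith
  -- Here `k = b₀λ₁` and `m = 4E(0)/(b₀λ₁)`; positivity of `λ₁` makes `km = 4E(0)` exact.
  · have hl := lambda1_pos hL hbdd (hne hpos)
    refine hsol.not_global_of_inner_pos hL (mul_pos hb0 hl).le hlarge (le_of_eq ?_) hquad ?_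
    · field_simp
    · rwa [inner_L2]
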